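/- **Definitions.** Let $(X,d)$ be a metric space. An *integral $(q,Q)$-quasi-geodesic* in $X$ is a function $g : (a,b)\cap\mathbb Z_+ \to X$ with $\frac{|i-j|}{q}-Q \le d(g(i),g(j)) \le q|i-j|+Q$ for all $i,j$ in its domain; it is a *ray* if its domain is $\mathbb Z_+=\{1,2,\dots\}$. $X$ is *(integrally) quasi-geodesic* if there are $q\ge 1$, $Q\ge 0$ such that any two points of $X$ are the first and last value of an integral $(q,Q)$-quasi-geodesic. A function $f:X\to\mathbb C$ is *slowly oscillating* if $|f(x_n)-f(y_n)|\to 0$ whenever $x_n\to\infty$ and $\sup_n d(x_n,y_n)<\infty$. A bounded continuous slowly oscillating function $f$ is *geometrically slowly oscillating* if for every $\epsilon>0$, every $k\ge1$ and every integral $(k,k)$-quasi-geodesic ray $g$ there is $m\ge 1$ such that $\{f(h(i)) : i\ge m\}$, with $h$ ranging over all integral $(k,k)$-quasi-geodesics satisfying $h(i)=g(i)$ for $1\le i\le m$ and $i$ over the domain of $h$, has diameter less than $\epsilon$. These functions form a $C^*$-algebra $C_{QG}(X)$ under the supremum norm. The *quasi-geodesic compactification* $X_{QG}$ is the space of characters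 of $C_{QG}(X)$ with the weak-* topology. Each $x\in X$ gives a point of $X_{QG}$, namely evaluation at $x$. The *quasi-geodesic boundary* is $\partial_{QG}X = X_{QG}\setminus X$. Its space of components carries the quotient topology. A subset $U\subseteq X$ is *coarsely clopen* if for each $r>0$ there is a bounded $B_r\subseteq X$ with $d(x,y)>r$ for all $x\in U\setminus B_r$, $y\in U^c\setminus B_r$. A *coarse end* of $X$ is a family $E$ of unbounded coarsely clopen subsets of $X$ that is closed under finite intersections and contains $U$ or $U^c$ for each coarsely clopen $U$ (an ultrafilter of coarsely clopen sets modulo bounded sets). The space of coarse ends has the topology generated by the sets $\{E : U\in E\}$, $U$ coarsely clopen. A point $p\in X_{QG}$ *lies at* $E$ if $p$ is in the closure of $U$ in $X_{QG}$ for every $U\in E$. **Proposition 7.1.** Let $X$ be a proper metric space. (a) There is a topological embedding $\Phi$ of the space of coarse ends of $X$ into the space of components of $\partial_{QG}X$ such that every point of the component $\Phi(E)$ lies at $E$, for each coarse end $E$. (b) If $X$ is moreover quasi-geodesic, there is a homeomorphism $\Phi$ from the space of coarse ends of $X$ onto the space of components of $\partial_{QG}X$ such that, for each coarse end $E$ and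 each $p\in\partial_{QG}X$, $p$ belongs to the component $\Phi(E)$ if and only if $p$ lies at $E$. -/

import Mathlib

open Filter Topology BoundedContinuousFunction

namespace QGBoundary

section Defs

variable {X : Type*} [MetricSpace X]

/-- `g` restricted to `D` is an integral `(q, Q)`-quasi-geodesic with domain `D`. The domains
`(a, b) ∩ ℤ₊` are exactly the order-connected sets of positive integers; the values of `g`
outside `D` play no role. -/
structure IsIntegralQuasiGeodesic (q Q : ℝ) (D : Set ℕ) (g : ℕ → X) : Prop where
  pos : ∀ i ∈ D, 1 ≤ i
  ordConnected : D.OrdConnected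
  lower : ∀ i ∈ D, ∀ j ∈ D, |(i : ℝ) - j| / q - Q ≤ dist (g i) (g j)
  upper : ∀ i ∈ D, ∀ j ∈ D, dist (g i) (g j) ≤ q * |(i : ℝ) - j| + Q

/-- Integral quasi-geodesic rays are those with domain all positive integers. -/
def IsIntegralQuasiGeodesicRay (q Q : ℝ) (g : ℕ → X) : Prop :=
  IsIntegralQuasiGeodesic q Q (Set.Ici 1) g

variable (X) in
/-- `X` is integrally quasi-geodesic: for some `q ≥ 1` and `Q ≥ 0`, any two points are joined by
an integral `(q, Q)`-quasi-geodesic. -/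
def IsIntegrallyQuasiGeodesic : Prop :=
  ∃ q Q : ℝ, 1 ≤ q ∧ 0 ≤ Q ∧ ∀ x y : X, ∃ (a b : ℕ) (g : ℕ → X), a ≤ b ∧
    IsIntegralQuasiGeodesic q Q (Set.Icc a b) g ∧ g a = x ∧ g b = y

/-- The `m`-thread of the fan of integral `(q, Q)`-quasi-geodesics starting at `x₀`, based at `g`:
those `h`, with domain `D`, that start at `x₀` and agree with `g` on `1, …, m`. -/
def InThread (x₀ : X) (q Q : ℝ) (g : ℕ → X) (m : ℕ) (D : Set ℕ) (h : ℕ → X) : Prop :=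
  IsIntegralQuasiGeodesic q Q D h ∧ 1 ∈ D ∧ h 1 = x₀ ∧ ∀ i, 1 ≤ i → i ≤ m → i ∈ D ∧ h i = g i

/-- The `m`-cone at `g`: the points `h i` with `i ≥ m` and `h` in the `m`-thread. -/
def cone (x₀ : X) (q Q : ℝ) (g : ℕ → X) (m : ℕ) : Set X :=
  {x | ∃ (D : Set ℕ) (h : ℕ → X), InThread x₀ q Q g m D h ∧ ∃ i ∈ D, m ≤ i ∧ h i = x}

/-- Slowly oscillating functions. -/
def IsSlowlyOscillating (f : X → ℂ) : Prop :=
  ∀ (x y : ℕ → X) (M : ℝ), Tendsto x atTop (Bornology.cobounded X) → 0 < M →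
    (∀ n, dist (x n) (y n) < M) → Tendsto (fun n => ‖f (x n) - f (y n)‖) atTop (𝓝 0)

/-- Geometrically slowly oscillating functions: bounded continuous slowly oscillating functions
whose oscillation on the `m`-cones at every integral `(k, k)`-quasi-geodesic ray is eventually as
small as one wishes. -/
structure IsGeomSlowlyOscillating (f : X → ℂ) : Prop where
  continuous : Continuous f
  bounded : Bornology.IsBounded (Set.range f)
  slow : IsSlowlyOscillating f
  cone_small : ∀ ε : ℝ, 0 < ε → ∀ (k : ℝ) (g : ℕ → X), 1 ≤ k →
    IsIntegralQuasiGeodesicRay k k g → ∃ m : ℕ, 1 ≤ m ∧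
      Metric.diam (f '' cone (g 1) k k g m) < ε

theorem cone_anti (x₀ : X) (q Q : ℝ) (g : ℕ → X) {m n : ℕ} (hmn : m ≤ n) :
    cone x₀ q Q g n ⊆ cone x₀ q Q g m := by
  rintro x ⟨D, h, ⟨hq, h1, h0, hag⟩, i, hi, hni, rfl⟩
  exact ⟨D, h, ⟨hq, h1, h0, fun j hj hjm => hag j hj (hjm.trans hmn)⟩, i, hi, hmn.trans hni, rfl⟩

/-- Pairwise form of the cone condition, convenient for algebra. -/
theorem IsGeomSlowlyOscillating.exists_cone {f : X → ℂ} (hf : IsGeomSlowlyOscillating f)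
    {ε : ℝ} (hε : 0 < ε) {k : ℝ} {g : ℕ → X} (hk : 1 ≤ k) (hg : IsIntegralQuasiGeodesicRay k k g) :
    ∃ m : ℕ, 1 ≤ m ∧ ∀ n, m ≤ n → ∀ x ∈ cone (g 1) k k g n, ∀ y ∈ cone (g 1) k k g n,
      ‖f x - f y‖ < ε := by
  obtain ⟨m, hm, hd⟩ := hf.cone_small ε hε k g hk hg
  refine ⟨m, hm, fun n hn x hx y hy => ?_⟩
  rw [← dist_eq_norm]
  exact (Metric.dist_le_diam_of_mem (hf.bounded.subset (Set.image_subset_range _ _))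
    (Set.mem_image_of_mem f (cone_anti _ _ _ _ hn hx))
    (Set.mem_image_of_mem f (cone_anti _ _ _ _ hn hy))).trans_lt hd

theorem isGeomSlowlyOscillating_of_bcf (f : X →ᵇ ℂ) (hs : IsSlowlyOscillating f)
    (hc : ∀ ε : ℝ, 0 < ε → ∀ (k : ℝ) (g : ℕ → X), 1 ≤ k → IsIntegralQuasiGeodesicRay k k g →
      ∃ m : ℕ, 1 ≤ m ∧ ∀ x ∈ cone (g 1) k k g m, ∀ y ∈ cone (g 1) k k g m, ‖f x - f y‖ ≤ ε) :
    IsGeomSlowlyOscillating (f : X → ℂ) where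
  continuous := f.continuous
  bounded := f.isBounded_range
  slow := hs
  cone_small ε hε k g hk hg := by
    obtain ⟨m, hm, h⟩ := hc (ε / 2) (by positivity) k g hk hg
    refine ⟨m, hm, (Metric.diam_le_of_forall_dist_le (by positivity) ?_).trans_lt
      (half_lt_self hε)⟩
    rintro _ ⟨x, hx, rfl⟩ _ ⟨y, hy, rfl⟩
    rw [dist_eq_norm]
    exact h x hx y hy

/-- A function dominated in oscillation by two geometrically slowly oscillating functions is
geometrically slowly oscillating. -/
theorem isGeomSlowlyOscillating_of_le (F f g : X →ᵇ ℂ) {C : ℝ} (hC : 0 < C)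
    (hf : IsGeomSlowlyOscillating (f : X → ℂ)) (hg : IsGeomSlowlyOscillating (g : X → ℂ))
    (hF : ∀ x y, ‖F x - F y‖ ≤ C * ‖f x - f y‖ + C * ‖g x - g y‖) :
    IsGeomSlowlyOscillating (F : X → ℂ) := by
  refine isGeomSlowlyOscillating_of_bcf F ?_ ?_
  · intro x y M hx hM hxy
    refine squeeze_zero (fun _ => norm_nonneg _) (fun n => hF (x n) (y n)) ?_
    simpa using ((hf.slow x y M hx hM hxy).const_mul C).add
      ((hg.slow x y M hx hM hxy).const_mul C)
  · intro ε hε k r hk hr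
    have hpos : 0 < ε / (2 * C) := by positivity
    obtain ⟨m, hm, h1⟩ := hf.exists_cone hpos hk hr
    obtain ⟨n, hn, h2⟩ := hg.exists_cone hpos hk hr
    refine ⟨max m n, hm.trans (le_max_left _ _), fun x hx y hy => (hF x y).trans ?_⟩
    have e1 := mul_le_mul_of_nonneg_left (h1 _ (le_max_left m n) x hx y hy).le hC.le
    have e2 := mul_le_mul_of_nonneg_left (h2 _ (le_max_right m n) x hx y hy).le hC.le
    have e3 : C * (ε / (2 * C)) + C * (ε / (2 * C)) = ε := by field_simp; ring
    linarith

theorem isGeomSlowlyOscillating_const (c : ℂ) :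
    IsGeomSlowlyOscillating (BoundedContinuousFunction.const X c : X → ℂ) := by
  refine isGeomSlowlyOscillating_of_bcf _ ?_ ?_
  · intro x y M _ _ _
    simp
  · intro ε hε k g _ _
    exact ⟨1, le_rfl, fun x _ y _ => by simpa using hε.le⟩

variable (X) in
/-- The unital `*`-algebra `C_QG(X)` of geometrically slowly oscillating functions, with the
supremum norm. -/
noncomputable def geomSlowlyOscillating : StarSubalgebra ℂ (X →ᵇ ℂ) where
  carrier := {f | IsGeomSlowlyOscillating (f : X → ℂ)}
  mul_mem' {f g} hf hg := by
    refine isGeomSlowlyOscillating_of_le (f * g) f g (C := ‖f‖ + ‖g‖ + 1) (by positivity)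
      hf hg fun x y => ?_
    have e : (f * g) x - (f * g) y = (f x - f y) * g x + f y * (g x - g y) := by
      simp only [BoundedContinuousFunction.mul_apply]; ring
    rw [e]
    refine (norm_add_le _ _).trans ?_
    rw [norm_mul, norm_mul, mul_comm ‖f x - f y‖]
    have h1 := g.norm_coe_le_norm x
    have h2 := f.norm_coe_le_norm y
    have h3 := norm_nonneg f
    have h4 := norm_nonneg g
    gcongr <;> linarith
  add_mem' {f g} hf hg := by
    refine isGeomSlowlyOscillating_of_le (f + g) f g one_pos hf hg fun x y => ?_
    have e : (f + g) x - (f + g) y = (f x - f y) + (g x - g y) := by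
      simp only [BoundedContinuousFunction.add_apply]; ring
    rw [e, one_mul, one_mul]
    exact norm_add_le _ _
  algebraMap_mem' c := isGeomSlowlyOscillating_const c
  star_mem' {f} hf := by
    refine isGeomSlowlyOscillating_of_le (star f) f f one_pos hf hf fun x y => ?_
    have e : (star f) x - (star f) y = star (f x - f y) := by
      simp [BoundedContinuousFunction.star_apply]
    rw [e, norm_star]
    linarith [norm_nonneg (f x - f y)]

variable (X) in
/-- The quasi-geodesic compactification `X_QG`: the maximal ideal space (the space of characters
with the weak-* topology) of `C_QG(X)`. -/
abbrev QGCompactification : Type _ :=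
  WeakDual.characterSpace ℂ (geomSlowlyOscillating X)

/-- The canonical map from `X` to `X_QG`, sending a point to the evaluation at it. -/
noncomputable def toQG (x : X) : QGCompactification X :=
  ⟨((BoundedContinuousFunction.evalCLM ℂ x).comp
      (geomSlowlyOscillating X).toSubalgebra.toSubmodule.subtypeL :
        geomSlowlyOscillating X →L[ℂ] ℂ), by
    refine ⟨fun h => ?_, fun f g => rfl⟩
    have h1 : (1 : ℂ) = 0 := DFunLike.congr_fun h (1 : geomSlowlyOscillating X)
    exact one_ne_zero h1⟩

theorem toQG_apply (x : X) (f : geomSlowlyOscillating X) : toQG x f = (f : X →ᵇ ℂ) x := rfl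

variable (X) in
/-- The quasi-geodesic boundary `∂_QG X`: the complement of (the image of) `X` in `X_QG`. -/
def qgBoundary : Set (QGCompactification X) := (Set.range (toQG (X := X)))ᶜ

/-- Coarsely clopen subsets. -/
def IsCoarselyClopen (U : Set X) : Prop :=
  ∀ r : ℝ, 0 < r → ∃ B : Set X, Bornology.IsBounded B ∧
    ∀ x ∈ U \ B, ∀ y ∈ Uᶜ \ B, r < dist x y

variable (X) in
/-- A coarse end: an ultrafilter of coarsely clopen subsets modulo bounded subsets. -/
@[ext] structure CoarseEnd where
  sets : Set (Set X)
  coarselyClopen : ∀ U ∈ sets, IsCoarselyClopen U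
  unbounded : ∀ U ∈ sets, ¬ Bornology.IsBounded U
  inter_mem : ∀ U ∈ sets, ∀ V ∈ sets, U ∩ V ∈ sets
  mem_or_compl_mem : ∀ U, IsCoarselyClopen U → U ∈ sets ∨ Uᶜ ∈ sets

/-- The topology on coarse ends generated by the sets of all ends containing a given coarsely
clopen set. -/
instance : TopologicalSpace (CoarseEnd X) :=
  TopologicalSpace.generateFrom
    {s | ∃ U : Set X, IsCoarselyClopen U ∧ s = {E : CoarseEnd X | U ∈ E.sets}}

/-- The point `p` of `X_QG` lies at the coarse end `E`: it is in the closure of each member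
of `E`. -/
def LiesAt (p : QGCompactification X) (E : CoarseEnd X) : Prop :=
  ∀ U ∈ E.sets, p ∈ closure (toQG '' U)

end Defs

end QGBoundary

namespace QGBoundary

/-! Coarsely clopen sets modulo bounded sets correspond to clopen subsets of the boundary. Given a
coarsely clopen `U`, a continuous function equal to the indicator of `U` off a bounded set is
constant at every fixed scale near infinity. It therefore lies in `C_QG(X)`, because a
quasi-geodesic moves by bounded steps, and its extension splits the boundary into the part in the
closure of `U` and the part in the closure of `Uᶜ` (`exists_apply_eq_zero_or_one`). Conversely,
Urysohn and Gelfand duality turn a clopen set into an element of the algebra with boundary values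
`0` and `1`, and slow oscillation makes `{Re > 1/2}` coarsely clopen
(`exists_isCoarselyClopen_of_isClopen`).

Hence sending a boundary point to the end at which it lies (`endAt`) is a continuous surjection
whose fibres are the quasi-components. In a compact Hausdorff space these are the components, so the
induced map is a continuous bijection from a compact space to a Hausdorff one. Its inverse is `Φ` in
both parts. -/

variable {X : Type*} [MetricSpace X]

/-! ### Gelfand duality for the algebra -/

/-- Uniform limits of geometrically slowly oscillating functions are geometrically slowly
oscillating. -/
theorem isClosed_geomSlowlyOscillating :
    IsClosed (geomSlowlyOscillating X : Set (X →ᵇ ℂ)) := by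
  refine isClosed_of_closure_subset fun f hf => ?_
  have approx : ∀ ε : ℝ, 0 < ε → ∃ g : X →ᵇ ℂ, IsGeomSlowlyOscillating (g : X → ℂ) ∧
      ∀ x y, ‖f x - f y‖ ≤ ‖g x - g y‖ + 2 * ε := by
    intro ε hε
    obtain ⟨g, hg, hfg⟩ := Metric.mem_closure_iff.1 hf ε hε
    refine ⟨g, hg, fun x y => ?_⟩
    have h1 := (BoundedContinuousFunction.dist_coe_le_dist (f := f) (g := g) x).trans hfg.le
    have h2 := (BoundedContinuousFunction.dist_coe_le_dist (f := f) (g := g) y).trans hfg.le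
    have h3 := dist_triangle4 (f x) (g x) (g y) (f y)
    rw [dist_comm (g y)] at h3
    rw [← dist_eq_norm, ← dist_eq_norm]
    linarith
  refine isGeomSlowlyOscillating_of_bcf f ?_ ?_
  · intro x y M hx hM hxy
    rw [Metric.tendsto_atTop]
    intro ε hε
    obtain ⟨g, hg, hfg⟩ := approx (ε / 4) (by positivity)
    obtain ⟨N, hN⟩ := Metric.tendsto_atTop.1 (hg.slow x y M hx hM hxy) (ε / 2) (by positivity)
    refine ⟨N, fun n hn => ?_⟩
    have h1 := hN n hn
    have h2 := hfg (x n) (y n)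
    simp only [dist_zero_right, norm_norm] at h1 ⊢
    linarith
  · intro ε hε k r hk hr
    obtain ⟨g, hg, hfg⟩ := approx (ε / 4) (by positivity)
    obtain ⟨m, hm, h⟩ := hg.exists_cone (half_pos hε) hk hr
    refine ⟨m, hm, fun x hx y hy => ?_⟩
    have h1 := h m le_rfl x hx y hy
    have h2 := hfg x y
    linarith

noncomputable instance : CommCStarAlgebra (geomSlowlyOscillating X) :=
  StarSubalgebra.commCStarAlgebra (geomSlowlyOscillating X)
    (h_closed := isClosed_geomSlowlyOscillating)

theorem exists_apply_eq (F : C(QGCompactification X, ℂ)) :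
    ∃ a : geomSlowlyOscillating X, ∀ p : QGCompactification X, p a = F p := by
  obtain ⟨a, ha⟩ := (gelfandTransform_bijective (geomSlowlyOscillating X)).2 F
  exact ⟨a, fun p => by rw [← ha]; rfl⟩

/-! ### Coarsely clopen sets and their indicator functions -/

theorem IsCoarselyClopen.compl {U : Set X} (hU : IsCoarselyClopen U) : IsCoarselyClopen Uᶜ := by
  intro r hr
  obtain ⟨B, hB, h⟩ := hU r hr
  refine ⟨B, hB, fun x hx y hy => ?_⟩
  rw [compl_compl] at hy
  rw [dist_comm]
  exact h y hy x hx

theorem isCoarselyClopen_empty : IsCoarselyClopen (∅ : Set X) :=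
  fun _ _ => ⟨∅, Bornology.isBounded_empty, fun _ hx => absurd hx.1 (Set.notMem_empty _)⟩

theorem IsCoarselyClopen.inter {U V : Set X} (hU : IsCoarselyClopen U)
    (hV : IsCoarselyClopen V) : IsCoarselyClopen (U ∩ V) := by
  intro r hr
  obtain ⟨B, hB, h⟩ := hU r hr
  obtain ⟨C, hC, h'⟩ := hV r hr
  refine ⟨B ∪ C, hB.union hC, fun x hx y hy => ?_⟩
  have hxB : x ∉ B := fun hb => hx.2 (Or.inl hb)
  have hxC : x ∉ C := fun hb => hx.2 (Or.inr hb)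
  have hyB : y ∉ B := fun hb => hy.2 (Or.inl hb)
  have hyC : y ∉ C := fun hb => hy.2 (Or.inr hb)
  by_cases hyU : y ∈ U
  · exact h' x ⟨hx.1.2, hxC⟩ y ⟨fun hyV => hy.1 ⟨hyU, hyV⟩, hyC⟩
  · exact h x ⟨hx.1.1, hxB⟩ y ⟨hyU, hyB⟩

/-- A function which is locally constant at every scale near infinity is geometrically slowly
oscillating. -/
theorem isGeomSlowlyOscillating_of_coarsely_locally_const (f : X →ᵇ ℂ)
    (hf : ∀ M : ℝ, 0 < M → ∃ C : Set X, Bornology.IsBounded C ∧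
      ∀ x ∉ C, ∀ y, dist x y < M → f x = f y) :
    IsGeomSlowlyOscillating (f : X → ℂ) := by
  refine isGeomSlowlyOscillating_of_bcf f ?_ ?_
  · intro x y M hx hM hxy
    obtain ⟨C, hC, h⟩ := hf M hM
    refine tendsto_const_nhds.congr' ?_
    filter_upwards [hx (Bornology.isBounded_def.1 hC)] with n hn
    rw [h (x n) hn (y n) (hxy n), sub_self, norm_zero]
  · intro ε hε k g hk hg
    -- Consecutive points of a `(k, k)`-quasi-geodesic are at distance at most `2 * k`.
    obtain ⟨C, hC, hCf⟩ := hf (2 * k + 1) (by positivity)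
    obtain ⟨R, hR⟩ := hC.subset_ball (g 1)
    -- For `i ≥ N + 1` the lower bound puts `h i` at distance at least `|R|` from `g 1`, hence
    -- outside `C`.
    obtain ⟨N, hN⟩ := exists_nat_ge (k * (|R| + k))
    -- Past index `N + 1`, `f` is constant along each `h`, and all `h` in the thread share the value
    -- at `g (N + 1)`.
    have key : ∀ x ∈ cone (g 1) k k g (N + 1), f x = f (g (N + 1)) := by
      rintro _ ⟨D, h, ⟨hq, h1, h0, hag⟩, i, hi, hni, rfl⟩
      induction i, hni using Nat.le_induction with
      | base => rw [(hag (N + 1) (by omega) le_rfl).2]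
      | succ i hni ih =>
        have hiD : i ∈ D := hq.ordConnected.out h1 hi ⟨by omega, by omega⟩
        rw [← ih hiD]
        refine (hCf (h i) (fun hmem => ?_) _ ?_).symm
        · have hd := Metric.mem_ball.1 (hR hmem)
          have hl := hq.lower i hiD 1 h1
          rw [h0] at hl
          have hi' : (N : ℝ) + 1 ≤ i := by exact_mod_cast hni
          have h2 : |R| + k ≤ |(i : ℝ) - (1 : ℕ)| / k := by
            rw [le_div_iff₀ (by positivity)]
            refine le_trans ?_ (le_abs_self _)
            push_cast
            linarith
          linarith [le_abs_self R]
        · have hu := hq.upper i hiD (i + 1) hi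
          have : |(i : ℝ) - ((i + 1 : ℕ) : ℝ)| = 1 := by push_cast; simp
          rw [this] at hu
          linarith
    exact ⟨N + 1, by omega, fun x hx y hy => by
      rw [key x hx, key y hy, sub_self, norm_zero]; exact hε.le⟩

/-- A function which is the indicator of a coarsely clopen set near infinity is geometrically
slowly oscillating. -/
theorem isGeomSlowlyOscillating_of_eq_indicator (f : X →ᵇ ℂ) {U B : Set X}
    (hU : IsCoarselyClopen U) (hB : Bornology.IsBounded B)
    (h1 : ∀ x ∈ U \ B, f x = 1) (h0 : ∀ x ∈ Uᶜ \ B, f x = 0) :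
    IsGeomSlowlyOscillating (f : X → ℂ) := by
  refine isGeomSlowlyOscillating_of_coarsely_locally_const f fun M hM => ?_
  obtain ⟨B', hB', hd⟩ := hU M hM
  -- Thickening by `M` keeps the nearby point `y`, not only `x`, outside `B ∪ B'`.
  refine ⟨Metric.thickening M (B ∪ B'), (hB.union hB').thickening, fun x hx y hxy => ?_⟩
  have hx' : x ∉ B ∪ B' := fun h => hx (Metric.self_subset_thickening hM _ h)
  have hy' : y ∉ B ∪ B' := fun h => hx (Metric.mem_thickening_iff.2 ⟨y, h, hxy⟩)
  rw [Set.mem_union, not_or] at hx' hy'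
  by_cases hxU : x ∈ U <;> by_cases hyU : y ∈ U
  · rw [h1 x ⟨hxU, hx'.1⟩, h1 y ⟨hyU, hy'.1⟩]
  · exact absurd (hd x ⟨hxU, hx'.2⟩ y ⟨hyU, hy'.2⟩) hxy.not_gt
  · exact absurd (hd y ⟨hyU, hy'.2⟩ x ⟨hxU, hx'.2⟩) (by rw [dist_comm]; exact hxy.not_gt)
  · rw [h0 x ⟨hxU, hx'.1⟩, h0 y ⟨hyU, hy'.1⟩]

/-- The complex-valued thickened indicator of a set. -/
theorem exists_thickenedIndicator (E : Set X) :
    ∃ f : X →ᵇ ℂ, (∀ x ∈ E, f x = 1) ∧ ∀ x ∉ Metric.thickening 1 E, f x = 0 := by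
  refine ⟨BoundedContinuousFunction.ofNormedAddCommGroup
    (fun x => (((thickenedIndicator one_pos E x : NNReal) : ℝ) : ℂ)) (by fun_prop) 1
      (fun x => ?_), fun x hx => ?_, fun x hx => ?_⟩
  · simpa using thickenedIndicator_le_one one_pos E x
  · simp [thickenedIndicatorAux_one 1 E hx]
  · simp [thickenedIndicatorAux_zero one_pos E hx]

theorem exists_eq_indicator {U : Set X} (hU : IsCoarselyClopen U) :
    ∃ (a : geomSlowlyOscillating X) (B : Set X), Bornology.IsBounded B ∧
      (∀ x ∈ U \ B, toQG x a = 1) ∧ ∀ x ∈ Uᶜ \ B, toQG x a = 0 := by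
  obtain ⟨B, hB, hd⟩ := hU 1 one_pos
  obtain ⟨f, h1, h0⟩ := exists_thickenedIndicator (U \ B)
  have h0' : ∀ x ∈ Uᶜ \ B, f x = 0 := fun x hx => h0 x fun hmem => by
    obtain ⟨z, hz, hxz⟩ := Metric.mem_thickening_iff.1 hmem
    exact absurd (hd z hz x hx) (by rw [dist_comm]; exact hxz.not_gt)
  exact ⟨⟨f, isGeomSlowlyOscillating_of_eq_indicator f hU hB h1 h0'⟩, B, hB, h1, h0'⟩

/-- Boundedly supported functions are indicators of `∅` near infinity; this one separates `x₀` from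
the boundary. -/
theorem exists_bump (x₀ : X) :
    ∃ (a : geomSlowlyOscillating X) (B : Set X), Bornology.IsBounded B ∧
      toQG x₀ a = 1 ∧ ∀ x ∉ B, toQG x a = 0 := by
  obtain ⟨f, h1, h0⟩ := exists_thickenedIndicator {x₀}
  have hB : Bornology.IsBounded (Metric.thickening 1 {x₀}) :=
    Bornology.isBounded_singleton.thickening
  exact ⟨⟨f, isGeomSlowlyOscillating_of_eq_indicator f isCoarselyClopen_empty hB
    (fun x hx => absurd hx.1 (Set.notMem_empty x)) fun x hx => h0 x hx.2⟩, _, hB, h1 x₀ rfl, h0⟩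

/-! ### The image of `X` and its boundary -/

theorem continuous_eval (a : geomSlowlyOscillating X) :
    Continuous fun p : QGCompactification X => p a :=
  map_continuous (WeakDual.gelfandTransform ℂ (geomSlowlyOscillating X) a)

theorem continuous_toQG : Continuous (toQG (X := X)) :=
  continuous_induced_rng.2 (WeakDual.continuous_of_continuous_eval fun a => (a : X →ᵇ ℂ).continuous)

theorem apply_mem_of_mem_closure {s : Set X} {p : QGCompactification X}
    (hp : p ∈ closure (toQG '' s)) (a : geomSlowlyOscillating X) {T : Set ℂ} (hT : IsClosed T)
    (h : ∀ x ∈ s, toQG x a ∈ T) : p a ∈ T := by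
  have : closure (toQG '' s) ⊆ (fun p : QGCompactification X => p a) ⁻¹' T :=
    closure_minimal (by rintro _ ⟨x, hx, rfl⟩; exact h x hx) (hT.preimage (continuous_eval a))
  exact this hp

/-- Otherwise a Urysohn function vanishing on the image of `X` but not at `p` would be the Gelfand
transform of `0`. -/
theorem denseRange_toQG : DenseRange (toQG (X := X)) := by
  intro p
  by_contra hp
  obtain ⟨F, hF0, hF1, -⟩ := exists_continuous_zero_one_of_isClosed
    (isClosed_closure (s := Set.range (toQG (X := X)))) (isClosed_singleton (x := p))
    (Set.disjoint_singleton_right.2 hp)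
  obtain ⟨a, ha⟩ := exists_apply_eq (X := X)
    ⟨fun q => (F q : ℂ), Complex.continuous_ofReal.comp F.continuous⟩
  have ha0 : a = 0 := by
    refine Subtype.ext (BoundedContinuousFunction.ext fun x => ?_)
    have h1 := ha (toQG x)
    have h2 : F (toQG x) = 0 := hF0 (subset_closure (Set.mem_range_self x))
    simpa [toQG_apply, h2] using h1
  have h1 := ha p
  have h2 : F p = 1 := hF1 rfl
  rw [ha0, map_zero] at h1
  simp [h2] at h1

theorem mem_closure_or_compl (U : Set X) (p : QGCompactification X) :
    p ∈ closure (toQG '' U) ∨ p ∈ closure (toQG '' Uᶜ) := by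
  have h := denseRange_toQG p
  rwa [← Set.image_univ, ← Set.union_compl_self U, Set.image_union, closure_union] at h

/-- Cluster points at infinity of the image of `X` lie in the boundary. -/
theorem mem_qgBoundary_of_mapClusterPt {ι : Type*} {l : Filter ι} {x : ι → X}
    (hx : Tendsto x l (Bornology.cobounded X)) {p : QGCompactification X}
    (hp : MapClusterPt p l (toQG ∘ x)) : p ∈ qgBoundary X := by
  rintro ⟨y, rfl⟩
  obtain ⟨a, B, hB, h1, h0⟩ := exists_bump y
  have hopen : {q : QGCompactification X | q a ≠ 0} ∈ 𝓝 (toQG y) :=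
    (isOpen_ne.preimage (continuous_eval a)).mem_nhds (by simp [h1])
  obtain ⟨n, hn, hn'⟩ := ((mapClusterPt_iff_frequently.1 hp _ hopen).and_eventually
    (hx (Bornology.isBounded_def.1 hB))).exists
  exact hn (h0 _ hn')

theorem notMem_closure_of_isBounded [ProperSpace X] {B : Set X} (hB : Bornology.IsBounded B)
    {p : QGCompactification X} (hp : p ∈ qgBoundary X) : p ∉ closure (toQG '' B) := by
  intro h
  have hc : IsClosed (toQG '' closure B) :=
    (hB.isCompact_closure.image continuous_toQG).isClosed
  obtain ⟨x, -, rfl⟩ := closure_minimal (Set.image_mono subset_closure) hc h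
  exact hp ⟨x, rfl⟩

theorem mem_closure_diff_of_isBounded [ProperSpace X] {U B : Set X} (hB : Bornology.IsBounded B)
    {p : QGCompactification X} (hp : p ∈ qgBoundary X) (h : p ∈ closure (toQG '' U)) :
    p ∈ closure (toQG '' (U \ B)) := by
  have h' : p ∈ closure (toQG '' (U \ B ∪ B)) :=
    closure_mono (Set.image_mono (by rw [Set.sdiff_union_self]; exact Set.subset_union_left)) h
  rw [Set.image_union, closure_union] at h'
  exact h'.resolve_right (notMem_closure_of_isBounded hB hp)

theorem isClosed_qgBoundary [ProperSpace X] : IsClosed (qgBoundary X) := by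
  rw [← isOpen_compl_iff, qgBoundary, compl_compl, isOpen_iff_mem_nhds]
  rintro _ ⟨x, rfl⟩
  obtain ⟨a, B, hB, h1, h0⟩ := exists_bump x
  filter_upwards [(isOpen_ne.preimage (continuous_eval a)).mem_nhds
    (show toQG x a ≠ 0 by simp [h1])] with q hq
  by_contra hq'
  refine hq (apply_mem_of_mem_closure (s := Bᶜ) (p := q) ?_ a isClosed_singleton h0)
  exact (mem_closure_or_compl B q).resolve_left (notMem_closure_of_isBounded hB hq')

instance [ProperSpace X] : CompactSpace (qgBoundary X) :=
  isCompact_iff_compactSpace.1 isClosed_qgBoundary.isCompact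

/-! ### Boundary points and coarse ends -/

/-- Every coarsely clopen set induces a clopen partition of the boundary. -/
theorem exists_apply_eq_zero_or_one [ProperSpace X] {U : Set X} (hU : IsCoarselyClopen U) :
    ∃ a : geomSlowlyOscillating X, ∀ p ∈ qgBoundary X,
      (p ∈ closure (toQG '' U) → p a = 1) ∧ (p ∈ closure (toQG '' Uᶜ) → p a = 0) := by
  obtain ⟨a, B, hB, h1, h0⟩ := exists_eq_indicator hU
  exact ⟨a, fun p hp => ⟨
    fun h => apply_mem_of_mem_closure (mem_closure_diff_of_isBounded hB hp h) a
      isClosed_singleton h1,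
    fun h => apply_mem_of_mem_closure (mem_closure_diff_of_isBounded hB hp h) a
      isClosed_singleton h0⟩⟩

theorem IsCoarselyClopen.mem_closure_compl_iff [ProperSpace X] {U : Set X}
    (hU : IsCoarselyClopen U) {p : QGCompactification X} (hp : p ∈ qgBoundary X) :
    p ∈ closure (toQG '' Uᶜ) ↔ p ∉ closure (toQG '' U) := by
  obtain ⟨a, ha⟩ := exists_apply_eq_zero_or_one hU
  refine ⟨fun h h' => ?_, (mem_closure_or_compl U p).resolve_left⟩
  exact one_ne_zero (((ha p hp).1 h').symm.trans ((ha p hp).2 h))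

/-- The coarse end at which a boundary point lies. -/
def endAt [ProperSpace X] (p : qgBoundary X) : CoarseEnd X where
  sets := {U | IsCoarselyClopen U ∧ (p : QGCompactification X) ∈ closure (toQG '' U)}
  coarselyClopen U hU := hU.1
  unbounded U hU hB := notMem_closure_of_isBounded hB p.2 hU.2
  inter_mem U hU V hV := by
    refine ⟨hU.1.inter hV.1, ?_⟩
    by_contra h
    rw [← (hU.1.inter hV.1).mem_closure_compl_iff p.2, Set.compl_inter, Set.image_union,
      closure_union] at h
    rcases h with h | h
    · exact (hU.1.mem_closure_compl_iff p.2).1 h hU.2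
    · exact (hV.1.mem_closure_compl_iff p.2).1 h hV.2
  mem_or_compl_mem U hU :=
    (mem_closure_or_compl U p).imp (fun h => ⟨hU, h⟩) fun h => ⟨hU.compl, h⟩

theorem CoarseEnd.notMem_of_compl_mem (E : CoarseEnd X) {U : Set X} (h : Uᶜ ∈ E.sets) :
    U ∉ E.sets := fun hU =>
  E.unbounded _ (E.inter_mem U hU _ h)
    (by rw [Set.inter_compl_self]; exact Bornology.isBounded_empty)

theorem CoarseEnd.eq_of_subset {E F : CoarseEnd X} (h : E.sets ⊆ F.sets) : E = F := by
  refine CoarseEnd.ext (h.antisymm fun U hU => ?_)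
  exact (E.mem_or_compl_mem U (F.coarselyClopen U hU)).resolve_right
    fun hc => F.notMem_of_compl_mem (h hc) hU

theorem liesAt_iff [ProperSpace X] (p : qgBoundary X) (E : CoarseEnd X) :
    LiesAt (p : QGCompactification X) E ↔ endAt p = E := by
  constructor
  · exact fun h => (CoarseEnd.eq_of_subset (F := endAt p)
      fun U hU => ⟨E.coarselyClopen U hU, h U hU⟩).symm
  · rintro rfl U hU
    exact hU.2

theorem isOpen_setOf_mem_sets {U : Set X} (hU : IsCoarselyClopen U) :
    IsOpen {E : CoarseEnd X | U ∈ E.sets} :=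
  TopologicalSpace.isOpen_generateFrom_of_mem ⟨U, hU, rfl⟩

instance : TotallySeparatedSpace (CoarseEnd X) := by
  refine (totallySeparatedSpace_iff _).2 fun E _ F _ hEF => ?_
  obtain ⟨U, hUE, hUF⟩ := Set.not_subset.1 (mt CoarseEnd.eq_of_subset hEF)
  have hU := E.coarselyClopen U hUE
  refine ⟨_, _, isOpen_setOf_mem_sets hU, isOpen_setOf_mem_sets hU.compl, hUE,
    (F.mem_or_compl_mem U hU).resolve_left hUF, fun G _ => G.mem_or_compl_mem U hU, ?_⟩
  exact Set.disjoint_left.2 fun G h h' => G.notMem_of_compl_mem h' h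

theorem continuous_endAt [ProperSpace X] : Continuous (endAt (X := X)) := by
  refine continuous_generateFrom_iff.2 ?_
  rintro _ ⟨U, hU, rfl⟩
  have : endAt ⁻¹' {E : CoarseEnd X | U ∈ E.sets} =
      (Subtype.val ⁻¹' closure (toQG '' Uᶜ) : Set (qgBoundary X))ᶜ := by
    ext p
    rw [Set.mem_compl_iff, Set.mem_preimage, Set.mem_preimage, hU.mem_closure_compl_iff p.2, not_not]
    exact ⟨fun h => h.2, fun h => ⟨hU, h⟩⟩
  rw [this]
  exact (isClosed_closure.preimage continuous_subtype_val).isOpen_compl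

/-- Compactness gives a cluster point of `U` along the filter of neighbourhoods of infinity. -/
theorem exists_mem_qgBoundary_mem_closure {U : Set X} (hU : ¬ Bornology.IsBounded U) :
    ∃ p ∈ qgBoundary X, p ∈ closure (toQG '' U) := by
  have hne : (Bornology.cobounded X ⊓ 𝓟 U).NeBot := by
    rw [inf_principal_neBot_iff]
    intro s hs
    by_contra h
    refine hU ((Bornology.isBounded_compl_iff.2 hs).subset fun x hx hxs => h ⟨x, hxs, hx⟩)
  obtain ⟨p, hp⟩ := exists_clusterPt_of_compactSpace (map toQG (Bornology.cobounded X ⊓ 𝓟 U))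
  refine ⟨p, mem_qgBoundary_of_mapClusterPt (x := id) (tendsto_id.mono_left inf_le_left) hp, ?_⟩
  exact hp.mem_closure_of_mem _ (image_mem_map (mem_inf_of_right (mem_principal_self U)))

theorem endAt_surjective [ProperSpace X] : Function.Surjective (endAt (X := X)) := by
  intro E
  have hne : Nonempty E.sets := by
    rcases E.mem_or_compl_mem ∅ isCoarselyClopen_empty with h | h
    exacts [⟨⟨_, h⟩⟩, ⟨⟨_, h⟩⟩]
  let C : E.sets → Set (qgBoundary X) := fun U => Subtype.val ⁻¹' closure (toQG '' (U : Set X))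
  have hC : ∀ U, IsClosed (C U) := fun U => isClosed_closure.preimage continuous_subtype_val
  -- The traces of the closures of members of `E` are directed downwards, so by compactness some
  -- boundary point lies in all of them.
  obtain ⟨p, hp⟩ := IsCompact.nonempty_iInter_of_directed_nonempty_isCompact_isClosed C
    (fun U V => ⟨⟨_, E.inter_mem U U.2 V V.2⟩,
      Set.preimage_mono (closure_mono (Set.image_mono Set.inter_subset_left)),
      Set.preimage_mono (closure_mono (Set.image_mono Set.inter_subset_right))⟩)
    (fun U => by
      obtain ⟨p, hp, h⟩ := exists_mem_qgBoundary_mem_closure (E.unbounded U U.2)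
      exact ⟨⟨p, hp⟩, h⟩)
    (fun U => (hC U).isCompact) hC
  exact ⟨p, (liesAt_iff p E).1 fun U hU => Set.mem_iInter.1 hp ⟨U, hU⟩⟩

/-! ### Clopen subsets of the boundary and its components -/

/-- If a function takes only the values `0` and `1` on the boundary then the set where its real
part exceeds `1 / 2` is coarsely clopen. -/
theorem isCoarselyClopen_of_apply_eq_zero_or_one [ProperSpace X] (a : geomSlowlyOscillating X)
    (ha : ∀ p ∈ qgBoundary X, p a = 0 ∨ p a = 1) :
    IsCoarselyClopen {x : X | 1 / 2 < (toQG x a).re} := by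
  intro r hr
  by_contra! hcon
  rcases isEmpty_or_nonempty X with hX | ⟨⟨x₀⟩⟩
  · obtain ⟨x, -⟩ := hcon ∅ Bornology.isBounded_empty
    exact hX.elim x
  choose x hx y hy hxy using fun n : ℕ =>
    hcon (Metric.ball x₀ (n : ℝ)) Metric.isBounded_ball
  have htend : ∀ z : ℕ → X, (∀ n : ℕ, z n ∉ Metric.ball x₀ (n : ℝ)) →
      Tendsto z atTop (Bornology.cobounded X) := by
    intro z hz
    rw [← Metric.tendsto_dist_right_atTop_iff x₀]
    exact tendsto_atTop_mono (fun n => not_lt.1 (hz n)) tendsto_natCast_atTop_atTop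
  have hxt := htend x fun n : ℕ => (hx n).2
  have hslow := a.2.slow x y (r + 1) hxt (by positivity) fun n => (hxy n).trans_lt (by linarith)
  obtain ⟨p, hp⟩ := exists_clusterPt_of_compactSpace (map (toQG ∘ x) atTop)
  have hpb := mem_qgBoundary_of_mapClusterPt hxt hp
  -- As `Re` exceeds `1/2` at `x n`, closeness `1/4` forces the value at `p` to be `1`; a further
  -- `1/4` by slow oscillation leaves `Re` above `1/2` at `y n`, a contradiction.
  have hnear : ∀ᶠ q in 𝓝 p, dist (q a) (p a) < 1 / 4 :=
    (continuous_eval a).continuousAt.eventually (Metric.ball_mem_nhds _ (by norm_num))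
  obtain ⟨n, hn, hn'⟩ := ((mapClusterPt_iff_frequently.1 hp _ hnear).and_eventually
    (hslow.eventually (gt_mem_nhds (show (0 : ℝ) < 1 / 4 by norm_num)))).exists
  have h1 : |(toQG (x n) a - p a).re| < 1 / 4 :=
    (Complex.abs_re_le_norm _).trans_lt (by simpa [dist_eq_norm] using hn)
  have h2 : |(toQG (x n) a - toQG (y n) a).re| < 1 / 4 := (Complex.abs_re_le_norm _).trans_lt hn'
  have h3 : 1 / 2 < (toQG (x n) a).re := (hx n).1
  have h4 : (toQG (y n) a).re ≤ 1 / 2 := not_lt.1 (hy n).1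
  rw [Complex.sub_re, abs_lt] at h1 h2
  rcases ha p hpb with h | h <;> rw [h] at h1 <;> norm_num at h1 <;> linarith

/-- Clopen subsets of the boundary are the traces of closures of coarsely clopen sets. -/
theorem exists_isCoarselyClopen_of_isClopen [ProperSpace X] {Z : Set (qgBoundary X)}
    (hZ : IsClopen Z) : ∃ U : Set X, IsCoarselyClopen U ∧
      ∀ p : qgBoundary X, p ∈ Z ↔ (p : QGCompactification X) ∈ closure (toQG '' U) := by
  have hemb := isClosed_qgBoundary (X := X).isClosedEmbedding_subtypeVal
  obtain ⟨F, hF0, hF1, -⟩ := exists_continuous_zero_one_of_isClosed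
    (hemb.isClosedMap _ hZ.compl.1) (hemb.isClosedMap _ hZ.1)
    ((Set.disjoint_image_iff Subtype.val_injective).2 disjoint_compl_left)
  obtain ⟨a, ha⟩ := exists_apply_eq (X := X)
    ⟨fun q => (F q : ℂ), Complex.continuous_ofReal.comp F.continuous⟩
  have h1 : ∀ p ∈ Z, (p : QGCompactification X) a = 1 := fun p hp => by
    have : F p = 1 := hF1 ⟨p, hp, rfl⟩
    simp [ha, this]
  have h0 : ∀ p ∉ Z, (p : QGCompactification X) a = 0 := fun p hp => by
    have : F p = 0 := hF0 ⟨p, hp, rfl⟩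
    simp [ha, this]
  refine ⟨{x | 1 / 2 < (toQG x a).re}, isCoarselyClopen_of_apply_eq_zero_or_one a fun p hp => ?_,
    fun p => ⟨fun hp => ?_, fun hp => ?_⟩⟩
  · by_cases h : (⟨p, hp⟩ : qgBoundary X) ∈ Z
    exacts [Or.inr (h1 _ h), Or.inl (h0 _ h)]
  · refine (mem_closure_or_compl _ _).resolve_right fun h => ?_
    have := apply_mem_of_mem_closure h a (isClosed_le Complex.continuous_re continuous_const)
      (T := {z : ℂ | z.re ≤ 1 / 2}) fun x (hx : ¬ 1 / 2 < (toQG x a).re) => not_lt.1 hx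
    rw [h1 p hp] at this
    norm_num at this
  · by_contra h
    have := apply_mem_of_mem_closure hp a (isClosed_le continuous_const Complex.continuous_re)
      (T := {z : ℂ | 1 / 2 ≤ z.re}) fun x (hx : 1 / 2 < (toQG x a).re) => hx.le
    rw [h0 p h] at this
    norm_num at this

theorem mk_eq_mk_iff_endAt_eq [ProperSpace X] (p q : qgBoundary X) :
    (p : ConnectedComponents (qgBoundary X)) = q ↔ endAt p = endAt q := by
  constructor
  · intro h
    exact (continuous_endAt.image_eq_of_connectedComponent_eq p q
      (ConnectedComponents.coe_eq_coe.1 h))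
  · intro h
    -- In the compact Hausdorff boundary it suffices to check that `p` lies in every clopen set
    -- containing `q`.
    rw [ConnectedComponents.coe_eq_coe', connectedComponent_eq_iInter_isClopen, Set.mem_iInter]
    rintro ⟨Z, hZ, hqZ⟩
    obtain ⟨U, hU, hUZ⟩ := exists_isCoarselyClopen_of_isClopen hZ
    have hUq : U ∈ (endAt q).sets := ⟨hU, (hUZ q).1 hqZ⟩
    rw [← h] at hUq
    exact (hUZ p).2 hUq.2

/-- The homeomorphism from the space of components of the boundary onto the space of coarse
ends. -/
noncomputable def componentsHomeo [ProperSpace X] :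
    ConnectedComponents (qgBoundary X) ≃ₜ CoarseEnd X :=
  Continuous.homeoOfEquivCompactToT2 (f := Equiv.ofBijective continuous_endAt.connectedComponentsLift
    ⟨by
      intro c d h
      obtain ⟨p, rfl⟩ := ConnectedComponents.surjective_coe c
      obtain ⟨q, rfl⟩ := ConnectedComponents.surjective_coe d
      exact (mk_eq_mk_iff_endAt_eq p q).2 h, fun E => by
      obtain ⟨p, hp⟩ := endAt_surjective E
      exact ⟨p, hp⟩⟩)
    continuous_endAt.connectedComponentsLift_continuous

theorem mk_eq_componentsHomeo_symm_iff [ProperSpace X] (E : CoarseEnd X) (p : qgBoundary X) :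
    ConnectedComponents.mk p = componentsHomeo.symm E ↔ LiesAt (p : QGCompactification X) E := by
  rw [liesAt_iff, Homeomorph.eq_symm_apply]
  rfl

end QGBoundary

/-- For a proper metric space the space of coarse ends embeds naturally into the space of
components of the quasi-geodesic boundary, and if the space is moreover integrally quasi-geodesic
then the two spaces are naturally homeomorphic. -/
theorem proposition7p1 {X : Type*} [MetricSpace X] [ProperSpace X] :
    (∃ Φ : QGBoundary.CoarseEnd X → ConnectedComponents (QGBoundary.qgBoundary X),
      Topology.IsEmbedding Φ ∧
      ∀ (E : QGBoundary.CoarseEnd X) (p : QGBoundary.qgBoundary X),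
        ConnectedComponents.mk p = Φ E → QGBoundary.LiesAt (p : QGBoundary.QGCompactification X) E) ∧
    (QGBoundary.IsIntegrallyQuasiGeodesic X →
      ∃ Φ : QGBoundary.CoarseEnd X ≃ₜ ConnectedComponents (QGBoundary.qgBoundary X),
        ∀ (E : QGBoundary.CoarseEnd X) (p : QGBoundary.qgBoundary X),
          ConnectedComponents.mk p = Φ E ↔
            QGBoundary.LiesAt (p : QGBoundary.QGCompactification X) E) := by
  exact ⟨⟨QGBoundary.componentsHomeo.symm, QGBoundary.componentsHomeo.symm.isEmbedding,
      fun E p => (QGBoundary.mk_eq_componentsHomeo_symm_iff E p).1⟩,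
    fun _ => ⟨QGBoundary.componentsHomeo.symm, QGBoundary.mk_eq_componentsHomeo_symm_iff⟩⟩
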